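/- Setting. Let $\mathcal X$ and $\mathcal Y$ be sets of inputs and labelings, let $\mathcal Y(x)\subseteq\mathcal Y$ be finite for every $x$, let $(x^i,y^i)_{i=1}^N$ be training pairs with $y^i\in\mathcal Y(x^i)$, let $\mathbf f:\mathcal X\times\mathcal Y\to\mathbb R^K$ be a feature map, and let $\Delta\ell_i(y)\in\mathbb R$ be the loss of predicting $y$ on example $i$ (e.g. the Hamming loss). Let $C\ge 0$, write $\Delta\mathbf f_i(y)=\mathbf f(x^i,y^i)-\mathbf f(x^i,y)$, and let "$y\ne y^i$" range over $y\in\mathcal Y(x^i)\setminus\{y^i\}$. The maximum margin Markov network (M$^3$N) is the problem $$\min_{w,\xi}\ \tfrac12\|w\|^2+C\sum_i\xi_i\quad\text{s.t.}\quad w^\top\Delta\mathbf f_i(y)\ge\Delta\ell_i(y)-\xi_i,\ \ \xi_i\ge0\qquad\forall i,\ \forall y\ne y^i,$$ with predictor $h_0(x;w)=\arg\max_{y\in\mathcal Y(x)}w^\top\mathbf f(x,y)$. The maximum entropy discrimination Markov network (MaxEnDNet) with discriminant $F(x,y;w)=w^\top\mathbf f(x,y)$, slack function $U(\xi)=C\sum_i\xi_i$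 and prior $p_0=\mathcal N(0,I)$ is the problem, over probability distributions $p$ on $\mathbb R^K$ under which the margins $\Delta F_i(y;w)=w^\top\Delta\mathbf f_i(y)$ are integrable, and over $\xi\in\mathbb R^N$, $$\min_{p,\xi}\ KL(p\|p_0)+U(\xi)\quad\text{s.t.}\quad\int\big[\Delta F_i(y;w)-\Delta\ell_i(y)\big]\,dp(w)\ge-\xi_i,\ \ \xi_i\ge0\qquad\forall i,\ \forall y\ne y^i,$$ with predictor $h_1(x)=\arg\max_{y\in\mathcal Y(x)}\int F(x,y;w)\,dp(w)$. Both $\arg\max$ are the sets of all maximizers. The Lagrangian dual function of either problem assigns to multipliers $\alpha=(\alpha_i(y))_{i,\,y\ne y^i}$ of its margin constraints the infimum of the Lagrangian over $w$ (respectively $p$) and $\xi\ge0$; its dual problem is to maximize this function over $\alpha\ge0$. Theorem (Gaussian MaxEnDNet: reduction of MEDN to M$^3$N). Consider the quadratic program $$\max_\alpha\ \sum_{i,\,y\ne y^i}\alpha_i(y)\Delta\ell_i(y)-\tfrac12\Big\|\sum_{i,\,y\ne y^i}\alpha_i(y)\Delta\mathbf f_i(y)\Big\|^2\quad\text{s.t.}\quad\sum_{y\in\mathcal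 Y(x^i)}\alpha_i(y)=C,\ \ \alpha_i(y)\ge0\qquad\forall i,\ \forall y\in\mathcal Y(x^i).$$ 1. The MaxEnDNet, the M$^3$N and the quadratic program all have solutions. For every solution $(p,\xi)$ of the MaxEnDNet and every solution $\alpha$ of the quadratic program, $p=\mathcal N(\mu,I)$ with $\mu=\sum_{i,\,y\ne y^i}\alpha_i(y)\Delta\mathbf f_i(y)$. 2. The Lagrangian dual functions of the MaxEnDNet and of the M$^3$N are identical: both equal the objective of the quadratic program if $\sum_{y\ne y^i}\alpha_i(y)\le C$ for all $i$, and $-\infty$ otherwise. Under the normalization $\sum_{y\in\mathcal Y(x^i)}\alpha_i(y)=C$ for all $i$ (which only fixes $\alpha_i(y^i)$, on which the dual functions do not depend), $\alpha$ solves the quadratic program if and only if it solves the dual problem of the MaxEnDNet, and if and only if it solves the dual problem of the M$^3$N. For every solution $(p,\xi)$ of the MaxEnDNet and every solution $\alpha$ of the quadratic program there is no duality gap, and $\sum_{y\ne y^i}\alpha_i(y)=C$ for every $i$ with $\xi_i>0$. 3. For every solution $(p,\xi)$ of the MaxEnDNet and every solution $(w,\zeta)$ of the M$^3$N, the predictor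 $h_1$ given by $p$ is identical to $h_0(\,\cdot\,;w)$. -/

import Mathlib

open MeasureTheory ProbabilityTheory InformationTheory

noncomputable section

/-- Data of a structured prediction problem: the finite set `feasible x` of labelings that are
admissible for the input `x`, training pairs `(input i, label i)` with admissible labels, and
the loss `loss i y` of predicting `y` on the `i`-th training example (for instance the Hamming
distance between `y` and `label i`). -/
structure StructuredData (X Y : Type*) (N : ℕ) where
  feasible : X → Finset Y
  input : Fin N → X
  label : Fin N → Y
  label_mem : ∀ i, label i ∈ feasible (input i)
  loss : Fin N → Y → ℝ

/-- The maximizers over the finite set `s` of a score function. -/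
def argmaxOn {Y : Type*} (s : Finset Y) (score : Y → ℝ) : Set Y :=
  {y | y ∈ s ∧ ∀ y' ∈ s, score y' ≤ score y}

/-- The linear discriminant function `wᵀ f(x, y)`. -/
def linearDiscriminant {X Y : Type*} {K : ℕ} (f : X → Y → EuclideanSpace ℝ (Fin K))
    (x : X) (y : Y) (w : EuclideanSpace ℝ (Fin K)) : ℝ :=
  inner ℝ w (f x y)

/-- The linear slack function `U(ξ) = C ∑ᵢ ξᵢ`. -/
def linearSlack {N : ℕ} (C : ℝ) (ξ : Fin N → ℝ) : ℝ := C * ∑ i, ξ i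

namespace StructuredData

variable {X Y : Type*} {N : ℕ} (D : StructuredData X Y N)

/-- The point predictor `h₀(x; w)`, as the set of all maximizing labelings. -/
def pointPredictor {W : Type*} (F : X → Y → W → ℝ) (w : W) (x : X) : Set Y :=
  argmaxOn (D.feasible x) (fun y => F x y w)

/-- The averaging predictor `h₁(x)` of a distribution `p` on the parameters, as the set of all
maximizing labelings. -/
def averagePredictor {W : Type*} [MeasurableSpace W] (F : X → Y → W → ℝ) (p : Measure W)
    (x : X) : Set Y :=
  argmaxOn (D.feasible x) (fun y => ∫ w, F x y w ∂p)

open Classical in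
/-- The feasible labelings of the `i`-th training input that differ from the true one. -/
def rivals (i : Fin N) : Finset Y := (D.feasible (D.input i)).filter (fun y => y ≠ D.label i)

/-- The margin `ΔFᵢ(y; w) = F(xⁱ, yⁱ; w) - F(xⁱ, y; w)`. -/
def margin {W : Type*} (F : X → Y → W → ℝ) (i : Fin N) (y : Y) (w : W) : ℝ :=
  F (D.input i) (D.label i) w - F (D.input i) y w

/-! ### The maximum entropy discrimination Markov network -/

section MaxEnDNet

variable {W : Type*} [MeasurableSpace W]

/-- `p` is a probability distribution for which the expected margins exist. -/
def Admissible (F : X → Y → W → ℝ) (p : Measure W) : Prop :=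
  IsProbabilityMeasure p ∧ ∀ i, ∀ y ∈ D.rivals i, Integrable (D.margin F i y) p

/-- `(p, ξ)` is feasible: `p` satisfies the expected margin constraints with slack `ξ ≥ 0`. -/
def MaxEnDNetFeasible (F : X → Y → W → ℝ) (p : Measure W) (ξ : Fin N → ℝ) : Prop :=
  D.Admissible F p ∧
  (∀ i, ∀ y ∈ D.rivals i, -ξ i ≤ ∫ w, (D.margin F i y w - D.loss i y) ∂p) ∧
  ∀ i, 0 ≤ ξ i

/-- The generalized relative entropy `KL(p ‖ p₀) + U(ξ)`. -/
def maxEnDNetObjective (U : (Fin N → ℝ) → ℝ) (p₀ p : Measure W) (ξ : Fin N → ℝ) : EReal :=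
  (klDiv p p₀ : EReal) + (U ξ : EReal)

/-- `(p, ξ)` minimizes `KL(p ‖ p₀) + U(ξ)` under the expected margin constraints. -/
def IsMaxEnDNetSolution (F : X → Y → W → ℝ) (U : (Fin N → ℝ) → ℝ) (p₀ p : Measure W)
    (ξ : Fin N → ℝ) : Prop :=
  D.MaxEnDNetFeasible F p ξ ∧
  ∀ (q : Measure W) (ζ : Fin N → ℝ), D.MaxEnDNetFeasible F q ζ →
    maxEnDNetObjective U p₀ p ξ ≤ maxEnDNetObjective U p₀ q ζ

/-- The Lagrangian dual function: the infimum of the Lagrangian over all `p` and `ξ ≥ 0`,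
with a multiplier `α i y` for each margin constraint. -/
def maxEnDNetDual (F : X → Y → W → ℝ) (U : (Fin N → ℝ) → ℝ) (p₀ : Measure W)
    (α : Fin N → Y → ℝ) : EReal :=
  ⨅ (p : Measure W) (_ : D.Admissible F p) (ξ : Fin N → ℝ) (_ : ∀ i, 0 ≤ ξ i),
    (klDiv p p₀ : EReal) +
      ((U ξ - ∑ i, ∑ y ∈ D.rivals i,
        α i y * ((∫ w, (D.margin F i y w - D.loss i y) ∂p) + ξ i) : ℝ) : EReal)

end MaxEnDNet

/-- `α` maximizes the dual function `g` among all multipliers that are nonnegative on the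
constraints. -/
def IsDualSolution (g : (Fin N → Y → ℝ) → EReal) (α : Fin N → Y → ℝ) : Prop :=
  (∀ i, ∀ y ∈ D.rivals i, 0 ≤ α i y) ∧
  ∀ β : Fin N → Y → ℝ, (∀ i, ∀ y ∈ D.rivals i, 0 ≤ β i y) → g β ≤ g α

section Linear

variable {K : ℕ} (f : X → Y → EuclideanSpace ℝ (Fin K))

/-- `Δfᵢ(y) = f(xⁱ, yⁱ) - f(xⁱ, y)`. -/
def featureDiff (i : Fin N) (y : Y) : EuclideanSpace ℝ (Fin K) :=
  f (D.input i) (D.label i) - f (D.input i) y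

/-! ### The maximum margin Markov network -/

/-- `(w, ξ)` satisfies the margin constraints with slack `ξ ≥ 0`. -/
def M3NFeasible (w : EuclideanSpace ℝ (Fin K)) (ξ : Fin N → ℝ) : Prop :=
  (∀ i, ∀ y ∈ D.rivals i, D.loss i y - ξ i ≤ inner ℝ w (D.featureDiff f i y)) ∧
  ∀ i, 0 ≤ ξ i

/-- `(w, ξ)` minimizes `½‖w‖² + C ∑ᵢ ξᵢ` under the margin constraints. -/
def IsM3NSolution (C : ℝ) (w : EuclideanSpace ℝ (Fin K)) (ξ : Fin N → ℝ) : Prop :=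
  D.M3NFeasible f w ξ ∧
  ∀ (v : EuclideanSpace ℝ (Fin K)) (ζ : Fin N → ℝ), D.M3NFeasible f v ζ →
    1 / 2 * ‖w‖ ^ 2 + C * ∑ i, ξ i ≤ 1 / 2 * ‖v‖ ^ 2 + C * ∑ i, ζ i

/-- The Lagrangian dual function of the maximum margin Markov network. -/
def m3nDual (C : ℝ) (α : Fin N → Y → ℝ) : EReal :=
  ⨅ (w : EuclideanSpace ℝ (Fin K)) (ξ : Fin N → ℝ) (_ : ∀ i, 0 ≤ ξ i),
    ((1 / 2 * ‖w‖ ^ 2 + C * ∑ i, ξ i - ∑ i, ∑ y ∈ D.rivals i,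
      α i y * (inner ℝ w (D.featureDiff f i y) - D.loss i y + ξ i) : ℝ) : EReal)

/-! ### The quadratic program -/

/-- `∑_{i, y ≠ yⁱ} αᵢ(y) Δfᵢ(y)`. -/
def posteriorMean (α : Fin N → Y → ℝ) : EuclideanSpace ℝ (Fin K) :=
  ∑ i, ∑ y ∈ D.rivals i, α i y • D.featureDiff f i y

/-- `∑_{i, y ≠ yⁱ} αᵢ(y) Δℓᵢ(y) - ½ ‖∑_{i, y ≠ yⁱ} αᵢ(y) Δfᵢ(y)‖²`. -/
def qpObjective (α : Fin N → Y → ℝ) : ℝ :=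
  ∑ i, ∑ y ∈ D.rivals i, α i y * D.loss i y - 1 / 2 * ‖D.posteriorMean f α‖ ^ 2

/-- The simplex constraints: for every `i`, the `αᵢ(y)` are nonnegative and sum to `C` over all
feasible labelings `y` of the `i`-th input, the true one included. -/
def QPFeasible (C : ℝ) (α : Fin N → Y → ℝ) : Prop :=
  (∀ i, ∑ y ∈ D.feasible (D.input i), α i y = C) ∧
  ∀ i, ∀ y ∈ D.feasible (D.input i), 0 ≤ α i y

/-- `α` solves the quadratic program over the simplex constraints. -/
def IsQPSolution (C : ℝ) (α : Fin N → Y → ℝ) : Prop :=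
  D.QPFeasible C α ∧
  ∀ β : Fin N → Y → ℝ, D.QPFeasible C β → D.qpObjective f β ≤ D.qpObjective f α

end Linear

end StructuredData

end

/-! Tilting `N(0, I)` by `exp ⟨x, m⟩` gives `N(m, I)`, so that `KL(p ‖ N(0, I)) = KL(p ‖ N(m, I)) +
E_p⟨x, m⟩ - ½‖m‖²` (`klDiv_stdGaussian_eq`). With `m` the posterior mean of `α`, the expected
margins cancel and the MaxEnDNet Lagrangian becomes `KL(p ‖ N(m, I)) + qpObjective α + ∑ᵢ (C - ∑ αᵢ)
ξᵢ`. Completing the square gives the M³N Lagrangian the same form, with `½‖w - m‖²` in place of the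
divergence. Both dual functions can be read off from this.

Strong duality needs no constraint qualification: first-order optimality of the quadratic program
yields slacks at `m` whose primal cost is at most the dual value (`IsQPSolution.exists_slack`).
Hence at any primal optimum the nonnegative gap terms vanish, which forces `p = N(m, I)`, `w = m`
and complementary slackness. The predictors agree because linear scores average to their value at
the mean. -/

/-! ### Exponential tilts of the standard Gaussian and relative entropy. -/

section GaussianTilt

variable {ι : Type*} [Fintype ι] [DecidableEq ι]

lemma map_inner_multivariateGaussian_one (m t : EuclideanSpace ℝ ι) :
    (multivariateGaussian m 1).map (fun x => inner ℝ x t)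
      = gaussianReal (inner ℝ m t) (‖t‖ ^ 2).toNNReal := by
  have hL : (fun x => inner ℝ x t) = (innerSL ℝ t : EuclideanSpace ℝ ι → ℝ) := by
    ext x; simp [real_inner_comm]
  rw [hL, IsGaussian.map_eq_gaussianReal, ContinuousLinearMap.integral_comp_id_comm]
  · have hvar : Var[innerSL ℝ t; multivariateGaussian m 1] = ‖t‖ ^ 2 := by
      have h := covarianceBilin_self (μ := multivariateGaussian m 1)
        IsGaussian.memLp_two_id t
      rw [covarianceBilin_multivariateGaussian Matrix.PosSemidef.one, Matrix.one_mulVec] at h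
      change Var[fun u => inner ℝ t u; multivariateGaussian m 1] = _
      rw [← h, EuclideanSpace.real_norm_sq_eq]
      simp [dotProduct, sq]
    rw [hvar]
    simp [real_inner_comm]
  · exact IsGaussian.integrable_id

lemma integrable_inner_multivariateGaussian_one (m t : EuclideanSpace ℝ ι) :
    Integrable (fun x => inner ℝ x t) (multivariateGaussian m 1) :=
  (IsGaussian.integrable_id (μ := multivariateGaussian m 1)).inner_const t

lemma integral_inner_multivariateGaussian_one (m t : EuclideanSpace ℝ ι) :
    ∫ x, inner ℝ x t ∂(multivariateGaussian m 1) = inner ℝ m t := by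
  have h := integral_inner (𝕜 := ℝ)
    (IsGaussian.integrable_id (μ := multivariateGaussian m (1 : Matrix ι ι ℝ))) t
  simp only [id_eq, integral_id_multivariateGaussian] at h
  simp_rw [real_inner_comm t]
  exact h

lemma mgf_inner_multivariateGaussian_one (m t : EuclideanSpace ℝ ι) (s : ℝ) :
    mgf (fun x => inner ℝ x t) (multivariateGaussian m 1) s
      = Real.exp (inner ℝ m t * s + ‖t‖ ^ 2 * s ^ 2 / 2) := by
  rw [mgf_gaussianReal (map_inner_multivariateGaussian_one m t),
    Real.coe_toNNReal _ (sq_nonneg _)]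

lemma integral_exp_inner_stdGaussian (t : EuclideanSpace ℝ ι) :
    ∫ x, Real.exp (inner ℝ x t) ∂(multivariateGaussian 0 1) = Real.exp (1 / 2 * ‖t‖ ^ 2) := by
  have h := mgf_inner_multivariateGaussian_one 0 t 1
  simp only [mgf, one_mul, inner_zero_left, one_pow, mul_one, zero_add] at h
  rw [h]; ring_nf

lemma integrable_exp_inner_multivariateGaussian_one (m t : EuclideanSpace ℝ ι) :
    Integrable (fun x => Real.exp (inner ℝ x t)) (multivariateGaussian m 1) := by
  have h : 0 < mgf (fun x => inner ℝ x t) (multivariateGaussian m 1) 1 := by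
    rw [mgf_inner_multivariateGaussian_one]; positivity
  simpa using mgf_pos_iff.1 h

/-- The moment generating functions agree in every direction; being finite everywhere, they
determine the complex one, and hence the characteristic function. -/
lemma tilted_inner_multivariateGaussian (m : EuclideanSpace ℝ ι) :
    (multivariateGaussian 0 1).tilted (fun x => inner ℝ x m) = multivariateGaussian m 1 := by
  have hprob : IsProbabilityMeasure
      ((multivariateGaussian 0 1).tilted (fun x : EuclideanSpace ℝ ι => inner ℝ x m)) :=
    isProbabilityMeasure_tilted (integrable_exp_inner_multivariateGaussian_one 0 m)
  have hmgf (t : EuclideanSpace ℝ ι) :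
      mgf (fun x => inner ℝ x t) (multivariateGaussian m 1)
        = mgf (fun x => inner ℝ x t)
          ((multivariateGaussian 0 1).tilted (fun x => inner ℝ x m)) := by
    ext s
    rw [mgf_inner_multivariateGaussian_one, mgf, integral_exp_tilted,
      integral_exp_inner_stdGaussian]
    have : ∀ x : EuclideanSpace ℝ ι, ((fun x => inner ℝ x m) + fun x => s * inner ℝ x t) x
        = inner ℝ x (m + s • t) := by
      intro x; simp [inner_add_right, inner_smul_right]
    simp_rw [this]
    rw [integral_exp_inner_stdGaussian, ← Real.exp_sub, norm_add_sq_real, norm_smul,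
      inner_smul_right, mul_pow, Real.norm_eq_abs, sq_abs]
    ring_nf
  refine (Measure.ext_of_charFun ?_).symm
  ext t
  have hset : integrableExpSet (fun x => inner ℝ x t) (multivariateGaussian m 1) = Set.univ := by
    ext s
    have := integrable_exp_inner_multivariateGaussian_one m (s • t)
    simpa [integrableExpSet, inner_smul_right] using this
  -- At the imaginary unit the complex mgf is the characteristic function.
  have := eqOn_complexMGF_of_mgf (hmgf t) (x := Complex.I) (by simp [hset])
  simpa [complexMGF, charFun_apply, mul_comm] using this

/-- The chain rule for the divergence from the standard Gaussian, relative to a translate. -/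
lemma klDiv_stdGaussian_eq {p : Measure (EuclideanSpace ℝ ι)} [IsProbabilityMeasure p]
    {m : EuclideanSpace ℝ ι} (hm : Integrable (fun x => inner ℝ x m) p)
    (hp : klDiv p (multivariateGaussian 0 1) ≠ ⊤) :
    klDiv p (multivariateGaussian m 1) ≠ ⊤ ∧
    (klDiv p (multivariateGaussian 0 1)).toReal
      = (klDiv p (multivariateGaussian m 1)).toReal
        + (∫ x, inner ℝ x m ∂p - 1 / 2 * ‖m‖ ^ 2) := by
  obtain ⟨hac, hint⟩ := klDiv_ne_top_iff.1 hp
  have hexp := integrable_exp_inner_multivariateGaussian_one 0 m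
  have hac' : p ≪ multivariateGaussian m 1 := by
    rw [← tilted_inner_multivariateGaussian m]
    exact hac.trans (absolutelyContinuous_tilted hexp)
  constructor
  · refine klDiv_ne_top hac' ?_
    rw [← tilted_inner_multivariateGaussian m]
    exact integrable_llr_tilted_right hac hm hint hexp
  · rw [toReal_klDiv_of_measure_eq hac (by simp), toReal_klDiv_of_measure_eq hac' (by simp),
      ← tilted_inner_multivariateGaussian m, integral_llr_tilted_right hac hm hexp hint,
      integral_exp_inner_stdGaussian, Real.log_exp]
    ring

/-- This is the chain rule with `p` the translate itself. Finiteness holds because the log-density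
is affine. -/
lemma klDiv_multivariateGaussian_stdGaussian (m : EuclideanSpace ℝ ι) :
    klDiv (multivariateGaussian m 1) (multivariateGaussian 0 1)
      = ENNReal.ofReal (1 / 2 * ‖m‖ ^ 2) := by
  have hm := integrable_inner_multivariateGaussian_one m m
  have hexp := integrable_exp_inner_multivariateGaussian_one 0 m
  have htop : klDiv (multivariateGaussian m 1) (multivariateGaussian 0 1) ≠ ⊤ := by
    have hac : multivariateGaussian m 1 ≪ multivariateGaussian 0 1 := by
      rw [← tilted_inner_multivariateGaussian m]
      exact tilted_absolutelyContinuous _ _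
    refine klDiv_ne_top hac ?_
    have h := log_rnDeriv_tilted_left_self hexp
    rw [tilted_inner_multivariateGaussian m] at h
    exact (integrable_congr (hac.ae_le h)).2 (hm.sub (integrable_const _))
  have h := (klDiv_stdGaussian_eq hm htop).2
  rw [klDiv_self, integral_inner_multivariateGaussian_one, real_inner_self_eq_norm_sq] at h
  rw [← ENNReal.ofReal_toReal htop, h]
  congr 1
  simp; ring

end GaussianTilt

/-! ### Algebra of the Lagrangian and of the quadratic objective. -/

namespace StructuredData

variable {X Y : Type*} {N : ℕ} (D : StructuredData X Y N)

lemma mem_rivals {i : Fin N} {y : Y} :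
    y ∈ D.rivals i ↔ y ∈ D.feasible (D.input i) ∧ y ≠ D.label i := by
  simp [rivals]

lemma sum_rivals (i : Fin N) (a : Y → ℝ) :
    ∑ y ∈ D.feasible (D.input i), a y = a (D.label i) + ∑ y ∈ D.rivals i, a y := by
  classical
  have h : D.rivals i = (D.feasible (D.input i)).erase (D.label i) := by
    ext y
    simp [mem_rivals, and_comm]
  rw [h, Finset.add_sum_erase _ _ (D.label_mem i)]

lemma mem_feasible_of_mem_rivals {i : Fin N} {y : Y} (h : y ∈ D.rivals i) :
    y ∈ D.feasible (D.input i) := (D.mem_rivals.1 h).1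

lemma ne_label_of_mem_rivals {i : Fin N} {y : Y} (h : y ∈ D.rivals i) : y ≠ D.label i :=
  (D.mem_rivals.1 h).2

/-- Common to both models: `k` is the regularizer, and `e` the margin, either at a point or in
expectation. -/
lemma lagrangian_eq (C k : ℝ) (ξ : Fin N → ℝ) (α e l : Fin N → Y → ℝ) :
    k + (C * ∑ i, ξ i - ∑ i, ∑ y ∈ D.rivals i, α i y * (e i y - l i y + ξ i))
      = k - ∑ i, ∑ y ∈ D.rivals i, α i y * e i y + ∑ i, ∑ y ∈ D.rivals i, α i y * l i y
        + ∑ i, (C - ∑ y ∈ D.rivals i, α i y) * ξ i := by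
  simp only [mul_add, mul_sub, sub_mul, Finset.sum_add_distrib, Finset.sum_sub_distrib,
    Finset.mul_sum, Finset.sum_mul]
  ring

variable {K : ℕ} (f : X → Y → EuclideanSpace ℝ (Fin K))

lemma inner_posteriorMean (w : EuclideanSpace ℝ (Fin K)) (α : Fin N → Y → ℝ) :
    inner ℝ w (D.posteriorMean f α)
      = ∑ i, ∑ y ∈ D.rivals i, α i y * inner ℝ w (D.featureDiff f i y) := by
  simp [posteriorMean, inner_sum, inner_smul_right]

lemma qpObjective_congr {α β : Fin N → Y → ℝ} (h : ∀ i, ∀ y ∈ D.rivals i, α i y = β i y) :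
    D.qpObjective f α = D.qpObjective f β := by
  have h1 : D.posteriorMean f α = D.posteriorMean f β :=
    Finset.sum_congr rfl fun i _ => Finset.sum_congr rfl fun y hy => by rw [h i y hy]
  rw [qpObjective, qpObjective, h1]
  congr 1
  exact Finset.sum_congr rfl fun i _ => Finset.sum_congr rfl fun y hy => by rw [h i y hy]

lemma posteriorMean_add_smul_sub (α β : Fin N → Y → ℝ) (t : ℝ) :
    D.posteriorMean f (α + t • (β - α))
      = D.posteriorMean f α + t • (D.posteriorMean f β - D.posteriorMean f α) := by
  simp only [posteriorMean, Pi.add_apply, Pi.smul_apply, Pi.sub_apply, add_smul, smul_sub,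
    sub_smul, Finset.sum_add_distrib, Finset.sum_sub_distrib, Finset.smul_sum, smul_eq_mul,
    mul_smul]

/-- The objective is quadratic, so its second-order expansion along a segment is exact. -/
lemma qpObjective_add_smul_sub (α β : Fin N → Y → ℝ) (t : ℝ) :
    D.qpObjective f (α + t • (β - α)) = D.qpObjective f α
      + t * (∑ i, ∑ y ∈ D.rivals i,
          β i y * (D.loss i y - inner ℝ (D.posteriorMean f α) (D.featureDiff f i y))
        - ∑ i, ∑ y ∈ D.rivals i,
          α i y * (D.loss i y - inner ℝ (D.posteriorMean f α) (D.featureDiff f i y)))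
      - t ^ 2 / 2 * ‖D.posteriorMean f β - D.posteriorMean f α‖ ^ 2 := by
  have hloss : ∑ i, ∑ y ∈ D.rivals i, (α + t • (β - α)) i y * D.loss i y
      = ∑ i, ∑ y ∈ D.rivals i, α i y * D.loss i y
        + t * (∑ i, ∑ y ∈ D.rivals i, β i y * D.loss i y
          - ∑ i, ∑ y ∈ D.rivals i, α i y * D.loss i y) := by
    simp only [Pi.add_apply, Pi.smul_apply, Pi.sub_apply, smul_eq_mul, add_mul, mul_sub, sub_mul,
      Finset.sum_add_distrib, Finset.sum_sub_distrib, Finset.mul_sum, mul_assoc]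
  rw [qpObjective, qpObjective, posteriorMean_add_smul_sub, hloss, norm_add_sq_real, norm_smul,
    inner_smul_right, inner_sub_right, mul_pow, Real.norm_eq_abs, sq_abs]
  simp only [mul_sub, Finset.sum_sub_distrib, ← inner_posteriorMean]
  ring

/-! ### The quadratic program: optimality conditions and existence. -/

variable {D f}

lemma QPFeasible.sum_rivals_le {C : ℝ} {α : Fin N → Y → ℝ} (h : D.QPFeasible C α) (i : Fin N) :
    ∑ y ∈ D.rivals i, α i y ≤ C := by
  have h1 := h.1 i
  rw [D.sum_rivals] at h1
  linarith [h.2 i _ (D.label_mem i)]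

lemma QPFeasible.nonneg {C : ℝ} {α : Fin N → Y → ℝ} (h : D.QPFeasible C α) (i : Fin N) :
    ∀ y ∈ D.rivals i, 0 ≤ α i y :=
  fun y hy => h.2 i y (D.mem_feasible_of_mem_rivals hy)

lemma qpFeasible_iff {C : ℝ} {α : Fin N → Y → ℝ}
    (hα : ∀ i, ∑ y ∈ D.feasible (D.input i), α i y = C) :
    D.QPFeasible C α ↔
      (∀ i, ∀ y ∈ D.rivals i, 0 ≤ α i y) ∧ ∀ i, ∑ y ∈ D.rivals i, α i y ≤ C := by
  refine ⟨fun h => ⟨h.nonneg, h.sum_rivals_le⟩, fun h => ⟨hα, fun i y hy => ?_⟩⟩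
  by_cases hy' : y = D.label i
  · have h1 := hα i
    rw [D.sum_rivals] at h1
    rw [hy']
    linarith [h.2 i]
  · exact h.1 i y (D.mem_rivals.2 ⟨hy, hy'⟩)

/-- The first-order optimality condition of the quadratic program. -/
lemma IsQPSolution.sum_le {C : ℝ} {α β : Fin N → Y → ℝ} (hα : D.IsQPSolution f C α)
    (hβ : D.QPFeasible C β) :
    ∑ i, ∑ y ∈ D.rivals i,
        β i y * (D.loss i y - inner ℝ (D.posteriorMean f α) (D.featureDiff f i y))
      ≤ ∑ i, ∑ y ∈ D.rivals i,
        α i y * (D.loss i y - inner ℝ (D.posteriorMean f α) (D.featureDiff f i y)) := by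
  have key : ∀ t ∈ Set.Ioc (0 : ℝ) 1, D.QPFeasible C (α + t • (β - α)) := by
    intro t ht
    refine ⟨fun i => ?_, fun i y hy => ?_⟩
    · simp only [Pi.add_apply, Pi.smul_apply, Pi.sub_apply, smul_eq_mul, Finset.sum_add_distrib,
        ← Finset.mul_sum, Finset.sum_sub_distrib, hα.1.1 i, hβ.1 i]
      ring
    · have h1 := mul_nonneg (sub_nonneg.2 ht.2) (hα.1.2 i y hy)
      have h2 := mul_nonneg ht.1.le (hβ.2 i y hy)
      simp only [Pi.add_apply, Pi.smul_apply, Pi.sub_apply, smul_eq_mul]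
      linarith
  by_contra! hlt
  set A := ∑ i, ∑ y ∈ D.rivals i,
    β i y * (D.loss i y - inner ℝ (D.posteriorMean f α) (D.featureDiff f i y))
  set B := ∑ i, ∑ y ∈ D.rivals i,
    α i y * (D.loss i y - inner ℝ (D.posteriorMean f α) (D.featureDiff f i y))
  set Q := ‖D.posteriorMean f β - D.posteriorMean f α‖ ^ 2
  have hQ : 0 ≤ Q := sq_nonneg _
  have hbound : ∀ t ∈ Set.Ioc (0 : ℝ) 1, A - B ≤ t / 2 * Q := by
    intro t ht
    have h := hα.2 _ (key t ht)
    rw [qpObjective_add_smul_sub] at h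
    have : t * (A - B) ≤ t * (t / 2 * Q) := by linarith
    exact le_of_mul_le_mul_left this ht.1
  have hd : 0 < A - B := sub_pos.2 hlt
  have hden : 0 < A - B + Q := by linarith
  -- This step length makes the quadratic term at most half of the linear gain, also when `Q = 0`.
  have h := hbound ((A - B) / (A - B + Q)) ⟨by positivity, (div_le_one hden).2 (by linarith)⟩
  have h2 : (A - B) / (A - B + Q) / 2 * Q ≤ (A - B) / 2 := by
    rw [div_div, div_mul_eq_mul_div, div_le_div_iff₀ (by positivity) two_pos]
    nlinarith
  linarith

/-- Complementary slackness: every solution of the quadratic program admits slacks of the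
margin constraints whose total cost is accounted for by the multipliers. -/
lemma IsQPSolution.exists_slack {C : ℝ} (hC : 0 ≤ C) {α : Fin N → Y → ℝ}
    (hα : D.IsQPSolution f C α) :
    ∃ ξ, D.M3NFeasible f (D.posteriorMean f α) ξ ∧
      1 / 2 * ‖D.posteriorMean f α‖ ^ 2 + C * ∑ i, ξ i ≤ D.qpObjective f α := by
  classical
  set m := D.posteriorMean f α with hm
  -- Setting the true label's violation to zero makes the maximum over feasible labelings
  -- nonnegative: it is the least admissible slack.
  set h : Fin N → Y → ℝ := fun i y =>
    if y = D.label i then 0 else D.loss i y - inner ℝ m (D.featureDiff f i y) with hh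
  have hrival : ∀ i, ∀ y ∈ D.rivals i,
      h i y = D.loss i y - inner ℝ m (D.featureDiff f i y) := fun i y hy =>
    if_neg (D.ne_label_of_mem_rivals hy)
  have hlabel : ∀ i, h i (D.label i) = 0 := fun i => if_pos rfl
  have hmax : ∀ i, ∃ y ∈ D.feasible (D.input i),
      ∀ y' ∈ D.feasible (D.input i), h i y' ≤ h i y := fun i =>
    Finset.exists_max_image _ _ ⟨_, D.label_mem i⟩
  choose b hb hbmax using hmax
  refine ⟨fun i => h i (b i), ⟨fun i y hy => ?_, fun i => ?_⟩, ?_⟩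
  · have := hbmax i y (D.mem_feasible_of_mem_rivals hy)
    rw [hrival i y hy] at this
    linarith
  · rw [← hlabel i]
    exact hbmax i _ (D.label_mem i)
  -- Test optimality against the vertex with all mass `C` on a most violated labeling.
  · have hβ : D.QPFeasible C (fun i => Pi.single (b i) C) := by
      refine ⟨fun i => ?_, fun i y _ => ?_⟩
      · exact (Finset.sum_pi_single' _ _ _).trans (if_pos (hb i))
      · by_cases hy : y = b i
        · subst hy; simpa using hC
        · simp [Pi.single_eq_of_ne hy]
    have hsum := hα.sum_le hβ
    have hβsum : ∑ i, ∑ y ∈ D.rivals i,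
        (Pi.single (b i) C : Y → ℝ) y * (D.loss i y - inner ℝ m (D.featureDiff f i y))
          = C * ∑ i, h i (b i) := by
      rw [Finset.mul_sum]
      refine Finset.sum_congr rfl fun i _ => ?_
      rw [Finset.sum_congr rfl fun y hy => by rw [← hrival i y hy]]
      have := D.sum_rivals i (fun y => (Pi.single (b i) C : Y → ℝ) y * h i y)
      simp only [hlabel, mul_zero, zero_add] at this
      rw [← this, Finset.sum_eq_single (b i)]
      · simp
      · intro y _ hy
        simp [Pi.single_eq_of_ne hy]
      · exact fun hn => absurd (hb i) hn
    rw [hβsum] at hsum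
    simp only [mul_sub, Finset.sum_sub_distrib, ← inner_posteriorMean, ← hm,
      real_inner_self_eq_norm_sq] at hsum
    rw [qpObjective, ← hm]
    linarith

/-- `Y` may be infinite and multipliers off the feasible labelings are unconstrained. Zeroing them
preserves feasibility and objective, so competitors in a box suffice. -/
lemma isQPSolution_of_truncated {C : ℝ} {α : Fin N → Y → ℝ} (hα : D.QPFeasible C α)
    (h : ∀ β, D.QPFeasible C β → (∀ i y, β i y ∈ Set.Icc 0 C) →
      D.qpObjective f β ≤ D.qpObjective f α) (hC : 0 ≤ C) : D.IsQPSolution f C α := by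
  classical
  refine ⟨hα, fun β hβ => ?_⟩
  set γ : Fin N → Y → ℝ := fun i y => if y ∈ D.feasible (D.input i) then β i y else 0 with hγ
  have heq : ∀ i, ∀ y ∈ D.feasible (D.input i), γ i y = β i y := fun i y hy => if_pos hy
  have heq' : ∀ i, ∀ y ∈ D.rivals i, γ i y = β i y := fun i y hy =>
    heq i y (D.mem_feasible_of_mem_rivals hy)
  have hγf : D.QPFeasible C γ :=
    ⟨fun i => (Finset.sum_congr rfl (heq i)).trans (hβ.1 i),
      fun i y hy => by rw [heq i y hy]; exact hβ.2 i y hy⟩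
  have hobj : D.qpObjective f γ = D.qpObjective f β := D.qpObjective_congr f heq'
  rw [← hobj]
  refine h γ hγf fun i y => ?_
  by_cases hy : y ∈ D.feasible (D.input i)
  · refine ⟨hγf.2 i y hy, ?_⟩
    rw [← hγf.1 i]
    exact Finset.single_le_sum (hγf.2 i) hy
  · simp [hγ, hy, hC]

variable (D f) in
-- The box is compact by Tychonoff, and the objective is continuous as it involves finitely many
-- coordinates.
lemma exists_isQPSolution {C : ℝ} (hC : 0 ≤ C) : ∃ α, D.IsQPSolution f C α := by
  classical
  set S : Set (Fin N → Y → ℝ) := Set.univ.pi fun _ => Set.univ.pi fun _ => Set.Icc 0 C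
  have hS : IsCompact S :=
    isCompact_univ_pi fun _ => isCompact_univ_pi fun _ => isCompact_Icc
  set T : Set (Fin N → Y → ℝ) := {α | ∀ i, ∑ y ∈ D.feasible (D.input i), α i y = C}
  have hT : IsClosed T := by
    simp only [T, Set.ofPred_forall]
    exact isClosed_iInter fun i => isClosed_eq (by fun_prop) continuous_const
  have hcont : Continuous (D.qpObjective f) := by
    unfold qpObjective posteriorMean
    fun_prop
  have hne : (S ∩ T).Nonempty := by
    refine ⟨fun i => Pi.single (D.label i) C, fun i _ y _ => ?_, fun i => ?_⟩
    · by_cases hy : y = D.label i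
      · subst hy; simp [hC]
      · simp [Pi.single_eq_of_ne hy, hC]
    · exact (Finset.sum_pi_single' _ _ _).trans (if_pos (D.label_mem i))
  obtain ⟨α, hα, hmax⟩ := (hS.inter_right hT).exists_isMaxOn hne hcont.continuousOn
  refine ⟨α, isQPSolution_of_truncated ⟨hα.2, fun i y _ => (hα.1 i trivial y trivial).1⟩ ?_ hC⟩
  exact fun β hβ hβC => hmax ⟨fun i _ y _ => hβC i y, hβ.1⟩

/-! ### Duality for the maximum margin Markov network. -/

lemma m3n_lagrangian_eq (C : ℝ) (w : EuclideanSpace ℝ (Fin K)) (ξ : Fin N → ℝ)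
    (α : Fin N → Y → ℝ) :
    1 / 2 * ‖w‖ ^ 2 + C * ∑ i, ξ i - ∑ i, ∑ y ∈ D.rivals i,
      α i y * (inner ℝ w (D.featureDiff f i y) - D.loss i y + ξ i)
      = 1 / 2 * ‖w - D.posteriorMean f α‖ ^ 2 + D.qpObjective f α
        + ∑ i, (C - ∑ y ∈ D.rivals i, α i y) * ξ i := by
  rw [add_sub_assoc, lagrangian_eq, ← inner_posteriorMean, norm_sub_sq_real, qpObjective]
  ring

lemma sum_slack_nonneg {C : ℝ} {α : Fin N → Y → ℝ} (hα : ∀ i, ∑ y ∈ D.rivals i, α i y ≤ C)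
    {ξ : Fin N → ℝ} (hξ : ∀ i, 0 ≤ ξ i) :
    0 ≤ ∑ i, (C - ∑ y ∈ D.rivals i, α i y) * ξ i :=
  Finset.sum_nonneg fun i _ => mul_nonneg (sub_nonneg.2 (hα i)) (hξ i)

/-- Weak duality, keeping the squared distance that later gives uniqueness of `w`. -/
lemma M3NFeasible.le_objective {C : ℝ} {w : EuclideanSpace ℝ (Fin K)} {ξ : Fin N → ℝ}
    (h : D.M3NFeasible f w ξ) {α : Fin N → Y → ℝ} (hα : D.QPFeasible C α) :
    1 / 2 * ‖w - D.posteriorMean f α‖ ^ 2 + D.qpObjective f α ≤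
      1 / 2 * ‖w‖ ^ 2 + C * ∑ i, ξ i := by
  have h1 := m3n_lagrangian_eq (D := D) (f := f) C w ξ α
  have h2 := sum_slack_nonneg hα.sum_rivals_le h.2
  have h3 : 0 ≤ ∑ i, ∑ y ∈ D.rivals i,
      α i y * (inner ℝ w (D.featureDiff f i y) - D.loss i y + ξ i) :=
    Finset.sum_nonneg fun i _ => Finset.sum_nonneg fun y hy =>
      mul_nonneg (hα.nonneg i y hy) (by linarith [h.1 i y hy])
  linarith

lemma IsQPSolution.exists_isM3NSolution {C : ℝ} (hC : 0 ≤ C) {α : Fin N → Y → ℝ}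
    (hα : D.IsQPSolution f C α) : ∃ ξ, D.IsM3NSolution f C (D.posteriorMean f α) ξ := by
  obtain ⟨ξ, hξ, hle⟩ := hα.exists_slack hC
  refine ⟨ξ, hξ, fun v ζ hv => ?_⟩
  have := hv.le_objective hα.1
  nlinarith [sq_nonneg ‖v - D.posteriorMean f α‖]

lemma IsM3NSolution.eq_posteriorMean {C : ℝ} (hC : 0 ≤ C) {w : EuclideanSpace ℝ (Fin K)}
    {ξ : Fin N → ℝ} (hw : D.IsM3NSolution f C w ξ) {α : Fin N → Y → ℝ}
    (hα : D.IsQPSolution f C α) : w = D.posteriorMean f α := by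
  obtain ⟨ζ, hζ, hle⟩ := hα.exists_slack hC
  have h1 := hw.2 _ _ hζ
  have h2 := hw.1.le_objective hα.1
  have h3 : ‖w - D.posteriorMean f α‖ ^ 2 = 0 :=
    le_antisymm (by linarith) (sq_nonneg _)
  exact sub_eq_zero.1 (norm_eq_zero.1 (pow_eq_zero_iff two_ne_zero |>.1 h3))

lemma m3nDual_eq {C : ℝ} {α : Fin N → Y → ℝ} (hα : ∀ i, ∑ y ∈ D.rivals i, α i y ≤ C) :
    D.m3nDual f C α = (D.qpObjective f α : EReal) := by
  unfold m3nDual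
  simp only [m3n_lagrangian_eq]
  refine le_antisymm ?_ (le_iInf fun w => le_iInf fun ξ => le_iInf fun hξ => ?_)
  · refine (iInf_le_of_le (D.posteriorMean f α) <| iInf_le_of_le 0 <|
      iInf_le_of_le (fun _ => le_rfl) ?_)
    simp
  · have := sum_slack_nonneg hα hξ
    rw [EReal.coe_le_coe_iff]
    nlinarith [sq_nonneg ‖w - D.posteriorMean f α‖]

lemma exists_sum_slack_lt {C : ℝ} {α : Fin N → Y → ℝ}
    (hα : ¬ ∀ i, ∑ y ∈ D.rivals i, α i y ≤ C) (r : ℝ) :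
    ∃ ξ : Fin N → ℝ, (∀ i, 0 ≤ ξ i) ∧ ∑ i, (C - ∑ y ∈ D.rivals i, α i y) * ξ i < r := by
  push Not at hα
  obtain ⟨i, hi⟩ := hα
  have hd : 0 < ∑ y ∈ D.rivals i, α i y - C := sub_pos.2 hi
  have hpos : 0 < (|r| + 1) / (∑ y ∈ D.rivals i, α i y - C) := by positivity
  -- A single slack with negative coefficient, scaled so that the sum is exactly `-(|r| + 1)`.
  refine ⟨Pi.single i ((|r| + 1) / (∑ y ∈ D.rivals i, α i y - C)), fun j => ?_, ?_⟩
  · by_cases hj : j = i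
    · subst hj; simpa using hpos.le
    · simp [Pi.single_eq_of_ne hj]
  · rw [Finset.sum_eq_single i (fun j _ hj => by simp [Pi.single_eq_of_ne hj]) (by simp),
      Pi.single_eq_same]
    have : (C - ∑ y ∈ D.rivals i, α i y) * ((|r| + 1) / (∑ y ∈ D.rivals i, α i y - C))
        = -(|r| + 1) := by
      field_simp
      ring
    rw [this]
    linarith [neg_abs_le r]

lemma m3nDual_eq_bot {C : ℝ} {α : Fin N → Y → ℝ}
    (hα : ¬ ∀ i, ∑ y ∈ D.rivals i, α i y ≤ C) : D.m3nDual f C α = ⊥ := by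
  unfold m3nDual
  simp only [m3n_lagrangian_eq]
  refine EReal.eq_bot_iff_forall_lt _ |>.2 fun r => ?_
  obtain ⟨ξ, hξ, hlt⟩ := exists_sum_slack_lt hα (r - D.qpObjective f α)
  refine lt_of_le_of_lt (iInf_le_of_le (D.posteriorMean f α) <| iInf_le_of_le ξ <|
      iInf_le_of_le hξ le_rfl) ?_
  rw [EReal.coe_lt_coe_iff]
  simp
  linarith

/-- A function that is given by the objective of the quadratic program where the multipliers of
each example sum to at most `C`, and is `-∞` elsewhere, has the same maximizers as the program. -/
lemma isQPSolution_iff_isDualSolution {C : ℝ} (hC : 0 ≤ C) {g : (Fin N → Y → ℝ) → EReal}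
    (hg : ∀ α, (∀ i, ∑ y ∈ D.rivals i, α i y ≤ C) → g α = (D.qpObjective f α : EReal))
    (hg' : ∀ α, ¬ (∀ i, ∑ y ∈ D.rivals i, α i y ≤ C) → g α = ⊥)
    {α : Fin N → Y → ℝ} (hα : ∀ i, ∑ y ∈ D.feasible (D.input i), α i y = C) :
    D.IsQPSolution f C α ↔ D.IsDualSolution g α := by
  classical
  constructor
  · refine fun h => ⟨h.1.nonneg, fun β hβ => ?_⟩
    by_cases hβC : ∀ i, ∑ y ∈ D.rivals i, β i y ≤ C
    -- The unused mass goes to the true label, which the objective ignores.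
    · set γ : Fin N → Y → ℝ := fun i =>
        Function.update (β i) (D.label i) (C - ∑ y ∈ D.rivals i, β i y) with hγ
      have heq : ∀ i, ∀ y ∈ D.rivals i, γ i y = β i y := fun i y hy =>
        Function.update_of_ne (D.ne_label_of_mem_rivals hy) _ _
      have hsum : ∀ i, ∑ y ∈ D.rivals i, γ i y = ∑ y ∈ D.rivals i, β i y := fun i =>
        Finset.sum_congr rfl (heq i)
      have hγf : D.QPFeasible C γ := by
        refine (qpFeasible_iff fun i => ?_).2 ⟨fun i y hy => ?_, fun i => ?_⟩
        · rw [D.sum_rivals, hsum]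
          simp [hγ]
        · rw [heq i y hy]; exact hβ i y hy
        · rw [hsum]; exact hβC i
      have hobj : D.qpObjective f γ = D.qpObjective f β := D.qpObjective_congr f heq
      rw [hg β hβC, hg α h.1.sum_rivals_le, EReal.coe_le_coe_iff, ← hobj]
      exact h.2 γ hγf
    · rw [hg' β hβC]
      exact bot_le
  · intro h
    have hαC : ∀ i, ∑ y ∈ D.rivals i, α i y ≤ C := by
      by_contra hn
      -- Zero multipliers have a finite dual value since `0 ≤ C`, so a maximizer cannot have value
      -- `⊥`.
      have h0 := h.2 0 (fun i y _ => le_rfl)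
      rw [hg' α hn, hg 0 (fun i => by simpa using hC)] at h0
      exact EReal.coe_ne_bot _ (le_bot_iff.1 h0)
    refine ⟨(qpFeasible_iff hα).2 ⟨h.1, hαC⟩, fun β hβ => ?_⟩
    have := h.2 β hβ.nonneg
    rwa [hg α hαC, hg β hβ.sum_rivals_le, EReal.coe_le_coe_iff] at this

end StructuredData

/-! ### Duality for the Gaussian MaxEnDNet. -/

namespace StructuredData

variable {X Y : Type*} {N K : ℕ} {D : StructuredData X Y N}
  {f : X → Y → EuclideanSpace ℝ (Fin K)} {C : ℝ} {α : Fin N → Y → ℝ} {ξ : Fin N → ℝ}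
  {p : Measure (EuclideanSpace ℝ (Fin K))}

lemma margin_linearDiscriminant (i : Fin N) (y : Y) :
    D.margin (linearDiscriminant f) i y = fun w => inner ℝ w (D.featureDiff f i y) := by
  ext w
  simp [margin, linearDiscriminant, featureDiff, inner_sub_right]

lemma Admissible.integral_margin_sub {F : X → Y → EuclideanSpace ℝ (Fin K) → ℝ}
    (h : D.Admissible F p) {i : Fin N} {y : Y} (hy : y ∈ D.rivals i) :
    ∫ w, (D.margin F i y w - D.loss i y) ∂p = ∫ w, D.margin F i y w ∂p - D.loss i y := by
  have := h.1
  rw [integral_sub (h.2 i y hy) (integrable_const _)]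
  simp

/-- `p` need not have a first moment; the posterior mean direction is a combination of margins, and
that is all the chain rule needs. -/
lemma Admissible.integrable_inner_posteriorMean (h : D.Admissible (linearDiscriminant f) p)
    (α : Fin N → Y → ℝ) : Integrable (fun w => inner ℝ w (D.posteriorMean f α)) p := by
  simp only [inner_posteriorMean]
  refine integrable_finsetSum _ fun i _ => integrable_finsetSum _ fun y hy => ?_
  have := h.2 i y hy
  rw [margin_linearDiscriminant] at this
  exact this.const_mul _

lemma Admissible.integral_inner_posteriorMean (h : D.Admissible (linearDiscriminant f) p)
    (α : Fin N → Y → ℝ) :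
    ∫ w, inner ℝ w (D.posteriorMean f α) ∂p
      = ∑ i, ∑ y ∈ D.rivals i, α i y * ∫ w, D.margin (linearDiscriminant f) i y w ∂p := by
  simp only [margin_linearDiscriminant, inner_posteriorMean]
  have hint : ∀ i, ∀ y ∈ D.rivals i,
      Integrable (fun w => α i y * inner ℝ w (D.featureDiff f i y)) p := by
    intro i y hy
    have := h.2 i y hy
    rw [margin_linearDiscriminant] at this
    exact this.const_mul _
  rw [integral_finsetSum _ fun i _ => integrable_finsetSum _ (hint i)]
  refine Finset.sum_congr rfl fun i _ => ?_
  rw [integral_finsetSum _ (hint i)]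
  exact Finset.sum_congr rfl fun y _ => integral_const_mul _ _

/-- The Lagrangian of the Gaussian MaxEnDNet, completed to a divergence from the minimizer. -/
lemma Admissible.lagrangian_eq (h : D.Admissible (linearDiscriminant f) p)
    (hp : klDiv p (multivariateGaussian 0 1) ≠ ⊤) (ξ : Fin N → ℝ) (α : Fin N → Y → ℝ) :
    (klDiv p (multivariateGaussian 0 1)).toReal
      + (linearSlack C ξ - ∑ i, ∑ y ∈ D.rivals i,
        α i y * ((∫ w, (D.margin (linearDiscriminant f) i y w - D.loss i y) ∂p) + ξ i))
      = (klDiv p (multivariateGaussian (D.posteriorMean f α) 1)).toReal + D.qpObjective f α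
        + ∑ i, (C - ∑ y ∈ D.rivals i, α i y) * ξ i := by
  have := h.1
  rw [Finset.sum_congr rfl fun i _ => Finset.sum_congr rfl fun y hy => by
    rw [h.integral_margin_sub hy], linearSlack, D.lagrangian_eq,
    ← h.integral_inner_posteriorMean,
    (klDiv_stdGaussian_eq (h.integrable_inner_posteriorMean α) hp).2, qpObjective]
  ring

lemma coe_klDiv_eq {q : Measure (EuclideanSpace ℝ (Fin K))} (h : klDiv p q ≠ ⊤) :
    (klDiv p q : EReal) = ((klDiv p q).toReal : EReal) :=
  (EReal.coe_ennreal_toReal h).symm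

lemma klDiv_multivariateGaussian_ne_top (m : EuclideanSpace ℝ (Fin K)) :
    klDiv (multivariateGaussian m 1) (multivariateGaussian 0 1) ≠ ⊤ := by
  rw [klDiv_multivariateGaussian_stdGaussian]
  exact ENNReal.ofReal_ne_top

variable (D f) in
lemma admissible_multivariateGaussian (m : EuclideanSpace ℝ (Fin K)) :
    D.Admissible (linearDiscriminant f) (multivariateGaussian m 1) := by
  refine ⟨inferInstance, fun i y _ => ?_⟩
  rw [margin_linearDiscriminant]
  exact integrable_inner_multivariateGaussian_one _ _

/-- Expected margins under the Gaussian are the margins at its mean. -/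
lemma M3NFeasible.maxEnDNetFeasible {m : EuclideanSpace ℝ (Fin K)} (h : D.M3NFeasible f m ξ) :
    D.MaxEnDNetFeasible (linearDiscriminant f) (multivariateGaussian m 1) ξ := by
  have had := D.admissible_multivariateGaussian f m
  refine ⟨had, fun i y hy => ?_, h.2⟩
  rw [had.integral_margin_sub hy, margin_linearDiscriminant,
    integral_inner_multivariateGaussian_one]
  linarith [h.1 i y hy]

lemma maxEnDNetObjective_multivariateGaussian (m : EuclideanSpace ℝ (Fin K)) :
    maxEnDNetObjective (linearSlack C) (multivariateGaussian 0 1) (multivariateGaussian m 1) ξ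
      = ((1 / 2 * ‖m‖ ^ 2 + C * ∑ i, ξ i : ℝ) : EReal) := by
  rw [maxEnDNetObjective, coe_klDiv_eq (klDiv_multivariateGaussian_ne_top m), linearSlack,
    klDiv_multivariateGaussian_stdGaussian, ENNReal.toReal_ofReal (by positivity),
    EReal.coe_add]

lemma maxEnDNetDual_eq (hα : ∀ i, ∑ y ∈ D.rivals i, α i y ≤ C) :
    D.maxEnDNetDual (linearDiscriminant f) (linearSlack C) (multivariateGaussian 0 1) α
      = (D.qpObjective f α : EReal) := by
  unfold maxEnDNetDual
  refine le_antisymm ?_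
    (le_iInf fun p => le_iInf fun hp => le_iInf fun ξ => le_iInf fun hξ => ?_)
  · have had := D.admissible_multivariateGaussian f (D.posteriorMean f α)
    refine iInf_le_of_le _ <| iInf_le_of_le had <| iInf_le_of_le 0 <|
      iInf_le_of_le (fun _ => le_rfl) ?_
    rw [coe_klDiv_eq (klDiv_multivariateGaussian_ne_top _), ← EReal.coe_add,
      had.lagrangian_eq (klDiv_multivariateGaussian_ne_top _)]
    simp
  -- The completed form needs finite divergence; otherwise the bound is trivial.
  · by_cases htop : klDiv p (multivariateGaussian 0 1) = ⊤
    · rw [htop, EReal.coe_ennreal_top, EReal.top_add_coe]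
      exact le_top
    · rw [coe_klDiv_eq htop, ← EReal.coe_add, hp.lagrangian_eq htop, EReal.coe_le_coe_iff]
      linarith [sum_slack_nonneg hα hξ, ENNReal.toReal_nonneg
        (a := klDiv p (multivariateGaussian (D.posteriorMean f α) 1))]

lemma maxEnDNetDual_eq_bot (hα : ¬ ∀ i, ∑ y ∈ D.rivals i, α i y ≤ C) :
    D.maxEnDNetDual (linearDiscriminant f) (linearSlack C) (multivariateGaussian 0 1) α = ⊥ := by
  unfold maxEnDNetDual
  refine EReal.eq_bot_iff_forall_lt _ |>.2 fun r => ?_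
  obtain ⟨ξ, hξ, hlt⟩ := exists_sum_slack_lt hα (r - D.qpObjective f α)
  have had := D.admissible_multivariateGaussian f (D.posteriorMean f α)
  refine lt_of_le_of_lt (iInf_le_of_le _ <| iInf_le_of_le had <| iInf_le_of_le ξ <|
    iInf_le_of_le hξ le_rfl) ?_
  rw [coe_klDiv_eq (klDiv_multivariateGaussian_ne_top _), ← EReal.coe_add,
    had.lagrangian_eq (klDiv_multivariateGaussian_ne_top _), EReal.coe_lt_coe_iff]
  simp
  linarith

/-- Weak duality with both gap terms kept: the divergence yields uniqueness, the slack sum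
complementary slackness. -/
lemma MaxEnDNetFeasible.le_objective
    (h : D.MaxEnDNetFeasible (linearDiscriminant f) p ξ)
    (hp : klDiv p (multivariateGaussian 0 1) ≠ ⊤) (hα : D.QPFeasible C α) :
    (klDiv p (multivariateGaussian (D.posteriorMean f α) 1)).toReal + D.qpObjective f α
        + ∑ i, (C - ∑ y ∈ D.rivals i, α i y) * ξ i
      ≤ (klDiv p (multivariateGaussian 0 1)).toReal + C * ∑ i, ξ i := by
  have h1 := h.1.lagrangian_eq (C := C) hp ξ α
  have h3 : 0 ≤ ∑ i, ∑ y ∈ D.rivals i,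
      α i y * ((∫ w, (D.margin (linearDiscriminant f) i y w - D.loss i y) ∂p) + ξ i) :=
    Finset.sum_nonneg fun i _ => Finset.sum_nonneg fun y hy =>
      mul_nonneg (hα.nonneg i y hy) (by linarith [h.2.1 i y hy])
  rw [linearSlack] at h1
  linarith

lemma IsQPSolution.exists_isMaxEnDNetSolution (hC : 0 ≤ C) (hα : D.IsQPSolution f C α) :
    ∃ ξ, D.IsMaxEnDNetSolution (linearDiscriminant f) (linearSlack C)
      (multivariateGaussian 0 1) (multivariateGaussian (D.posteriorMean f α) 1) ξ := by
  obtain ⟨ξ, hξ, hle⟩ := hα.exists_slack hC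
  refine ⟨ξ, hξ.maxEnDNetFeasible, fun q ζ hq => ?_⟩
  rw [maxEnDNetObjective_multivariateGaussian]
  by_cases htop : klDiv q (multivariateGaussian 0 1) = ⊤
  · rw [maxEnDNetObjective, htop, EReal.coe_ennreal_top, EReal.top_add_coe]
    exact le_top
  · rw [maxEnDNetObjective, coe_klDiv_eq htop, ← EReal.coe_add, EReal.coe_le_coe_iff]
    have h1 := hq.le_objective htop hα.1
    have h2 := sum_slack_nonneg hα.1.sum_rivals_le hq.2.2
    have h3 := ENNReal.toReal_nonneg
      (a := klDiv q (multivariateGaussian (D.posteriorMean f α) 1))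
    rw [linearSlack]
    linarith

/-- Strong duality for the Gaussian MaxEnDNet, with uniqueness of the optimal distribution and
complementary slackness. -/
lemma IsMaxEnDNetSolution.duality (hC : 0 ≤ C)
    (h : D.IsMaxEnDNetSolution (linearDiscriminant f) (linearSlack C)
      (multivariateGaussian 0 1) p ξ) (hα : D.IsQPSolution f C α) :
    p = multivariateGaussian (D.posteriorMean f α) 1 ∧
    (D.qpObjective f α : EReal)
      = maxEnDNetObjective (linearSlack C) (multivariateGaussian 0 1) p ξ ∧
    ∀ i, 0 < ξ i → ∑ y ∈ D.rivals i, α i y = C := by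
  obtain ⟨ζ, hζ, hle⟩ := hα.exists_slack hC
  have hprob := h.1.1.1
  have hopt := h.2 _ _ hζ.maxEnDNetFeasible
  rw [maxEnDNetObjective_multivariateGaussian] at hopt
  have htop : klDiv p (multivariateGaussian 0 1) ≠ ⊤ := by
    intro htop
    rw [maxEnDNetObjective, htop, EReal.coe_ennreal_top, EReal.top_add_coe] at hopt
    exact EReal.coe_ne_top _ (top_le_iff.1 hopt)
  rw [maxEnDNetObjective, coe_klDiv_eq htop, ← EReal.coe_add, EReal.coe_le_coe_iff,
    linearSlack] at hopt
  have h1 := h.1.le_objective htop hα.1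
  have h2 := sum_slack_nonneg hα.1.sum_rivals_le h.1.2.2
  have h3 := ENNReal.toReal_nonneg
    (a := klDiv p (multivariateGaussian (D.posteriorMean f α) 1))
  have hkl := (klDiv_stdGaussian_eq (h.1.1.integrable_inner_posteriorMean α) htop).1
  -- The primal value lies between the dual value plus two nonnegative gaps and, by `hopt` and
  -- `hle`, the dual value, so both gaps are zero.
  refine ⟨?_, ?_, fun i hi => ?_⟩
  · have h0 : (klDiv p (multivariateGaussian (D.posteriorMean f α) 1)).toReal = 0 := by linarith
    exact klDiv_eq_zero_iff.1 (((ENNReal.toReal_eq_zero_iff _).1 h0).resolve_right hkl)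
  · rw [maxEnDNetObjective, coe_klDiv_eq htop, ← EReal.coe_add, EReal.coe_eq_coe_iff, linearSlack]
    linarith
  · have h0 : ∑ i, (C - ∑ y ∈ D.rivals i, α i y) * ξ i = 0 := by linarith
    have hi0 := (Finset.sum_eq_zero_iff_of_nonneg fun i _ =>
      mul_nonneg (sub_nonneg.2 (hα.1.sum_rivals_le i)) (h.1.2.2 i)).1 h0 i (Finset.mem_univ i)
    linarith [(mul_eq_zero.1 hi0).resolve_right hi.ne']

end StructuredData

theorem theorem3 {X Y : Type*} {N K : ℕ} (D : StructuredData X Y N)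
    (f : X → Y → EuclideanSpace ℝ (Fin K)) (C : ℝ) (hC : 0 ≤ C)
    (F : X → Y → EuclideanSpace ℝ (Fin K) → ℝ) (hF : F = linearDiscriminant f)
    (U : (Fin N → ℝ) → ℝ) (hU : U = linearSlack C)
    (p₀ : Measure (EuclideanSpace ℝ (Fin K))) (hp₀ : p₀ = multivariateGaussian 0 1) :
    -- the three optimization problems have solutions
    (∃ p ξ, D.IsMaxEnDNetSolution F U p₀ p ξ) ∧
    (∃ w ξ, D.IsM3NSolution f C w ξ) ∧
    (∃ α, D.IsQPSolution f C α) ∧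
    -- the optimal distribution is normal with identity covariance and mean given by any
    -- solution of the quadratic program
    (∀ p ξ α, D.IsMaxEnDNetSolution F U p₀ p ξ → D.IsQPSolution f C α →
      p = multivariateGaussian (D.posteriorMean f α) 1) ∧
    -- the dual functions of the two models agree, and are given by the quadratic program
    (∀ α, (∀ i, ∑ y ∈ D.rivals i, α i y ≤ C) →
      D.maxEnDNetDual F U p₀ α = (D.qpObjective f α : EReal) ∧
      D.m3nDual f C α = (D.qpObjective f α : EReal)) ∧
    (∀ α, ¬ (∀ i, ∑ y ∈ D.rivals i, α i y ≤ C) →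
      D.maxEnDNetDual F U p₀ α = ⊥ ∧ D.m3nDual f C α = ⊥) ∧
    -- solving the quadratic program is the same as solving either dual problem, once the value
    -- at the true label (on which the duals do not depend) is fixed by normalization
    (∀ α, (∀ i, ∑ y ∈ D.feasible (D.input i), α i y = C) →
      (D.IsQPSolution f C α ↔ D.IsDualSolution (D.maxEnDNetDual F U p₀) α) ∧
      (D.IsQPSolution f C α ↔ D.IsDualSolution (D.m3nDual f C) α)) ∧
    -- the solutions of the quadratic program are Lagrange multipliers (no duality gap), and
    -- where the optimal slack is positive they sum to `C` over the labels other than the true one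
    (∀ p ξ α, D.IsMaxEnDNetSolution F U p₀ p ξ → D.IsQPSolution f C α →
      D.maxEnDNetDual F U p₀ α = StructuredData.maxEnDNetObjective U p₀ p ξ ∧
      ∀ i, 0 < ξ i → ∑ y ∈ D.rivals i, α i y = C) ∧
    -- the averaging predictor coincides with the predictor of the maximum margin Markov network
    (∀ p ξ w ζ, D.IsMaxEnDNetSolution F U p₀ p ξ → D.IsM3NSolution f C w ζ →
      ∀ x, (∀ y, Integrable (F x y) p) ∧
        D.averagePredictor F p x = D.pointPredictor F w x) := by

  subst hF hU hp₀
  obtain ⟨α₀, hα₀⟩ := D.exists_isQPSolution f hC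
  refine ⟨⟨_, hα₀.exists_isMaxEnDNetSolution hC⟩, ⟨_, hα₀.exists_isM3NSolution hC⟩, ⟨α₀, hα₀⟩,
    fun p ξ α hp hα => (hp.duality hC hα).1,
    fun α hα => ⟨StructuredData.maxEnDNetDual_eq hα, StructuredData.m3nDual_eq hα⟩,
    fun α hα => ⟨StructuredData.maxEnDNetDual_eq_bot hα, StructuredData.m3nDual_eq_bot hα⟩,
    fun α hα => ⟨?_, ?_⟩, fun p ξ α hp hα => ?_, fun p ξ w ζ hp hw x => ?_⟩
  · exact StructuredData.isQPSolution_iff_isDualSolution hC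
      (fun _ => StructuredData.maxEnDNetDual_eq) (fun _ => StructuredData.maxEnDNetDual_eq_bot) hα
  · exact StructuredData.isQPSolution_iff_isDualSolution hC
      (fun _ => StructuredData.m3nDual_eq) (fun _ => StructuredData.m3nDual_eq_bot) hα
  · rw [StructuredData.maxEnDNetDual_eq hα.1.sum_rivals_le]
    exact (hp.duality hC hα).2
  -- One solution `α₀` identifies both the mean of `p` and `w`.
  · rw [(hp.duality hC hα₀).1, hw.eq_posteriorMean hC hα₀]
    refine ⟨fun y => integrable_inner_multivariateGaussian_one _ _, ?_⟩
    simp only [StructuredData.averagePredictor, StructuredData.pointPredictor,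
      linearDiscriminant, integral_inner_multivariateGaussian_one]
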